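/- Let $d\in\mathbb N$ and let $\mathsf G$ be a function on $]0,\infty[$ whose values are symmetric linear operators on the space of real symmetric $d\times d$ matrices, with scalar product $\langle E,F\rangle=E_{ij}F_{ij}$ and components $G_{ijkl}(t)$. Assume that $\mathsf G$ is completely monotonic, i.e. for every real symmetric $E$ the function $f(t)=\langle E,\mathsf G(t)E\rangle$ is infinitely differentiable and $(-1)^m f^{(m)}(t)\ge 0$ for all $m\ge 0$, $t>0$; that the limit $\mathsf G^0=\lim_{t\to0+}\mathsf G(t)$ exists (is finite); and that $\mathsf G^\infty=\lim_{t\to\infty}\mathsf G(t)$ is positive definite (a viscoelastic solid). Let $\rho>0$ and let $\mathbf n\in\mathbb R^d$ be a unit vector. Let $\mathsf Q(p)=p\int_0^\infty e^{-pt}\,\mathsf G(t)\,dt$ for $\Re p>0$, extended by continuity to $\Re p\ge 0$, let $\mathbf Q_{\mathbf n}(p)$ be the matrix with entries $(\mathbf Q_{\mathbf n}(p))_{ik}=\sum_{j,l}Q_{ijkl}(p)\,n_jn_l$ and $\mathbf G^0_{\mathbf n}$ the matrix with entries $\sum_{j,l}G^0_{ijkl}\,n_jn_l$. For $\Re p\ge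 0$ put $$\mathbf K_{\mathbf n}(p)=\rho^{1/2}\,p\,\mathbf Q_{\mathbf n}(p)^{-1/2},\qquad \mathbf B_{\mathbf n}=\left(\rho^{-1}\mathbf G^0_{\mathbf n}\right)^{-1/2},$$ where the square roots are principal (all eigenvalues in the open right half-plane). For $\omega>0$ let $$\mathbf A_{\mathbf n}(\omega)=\Re\,\mathbf K_{\mathbf n}(-\mathrm i\omega),\qquad \mathbf C_{\mathbf n}(\omega)=\Re\left[\mathbf K_{\mathbf n}(-\mathrm i\omega)/(-\mathrm i\omega)\right]$$ be the attenuation function and the inverse phase speed, where $\Re\mathbf M=\tfrac12(\mathbf M+\mathbf M^\dagger)$ for a complex matrix $\mathbf M$. Then: 1. $\mathbf B_{\mathbf n}$ is real symmetric positive definite and $\mathbf B_{\mathbf n}^2\,\rho^{-1}\mathbf G^0_{\mathbf n}=\mathbf I$. 2. $\mathbf K_{\mathbf n}(p)=p\,\mathbf B_{\mathbf n}+\mathbf K^{(1)}_{\mathbf n}(p)$, where $\mathbf K^{(1)}_{\mathbf n}(p)=\mathrm o(p)$ as $|p|\to\infty$ in $\Re p\ge 0$. 3. Whenever $\mathbf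 K_{\mathbf n}$ is represented as $$\mathbf K_{\mathbf n}(p)=p\,\mathbf B+p\int_{]0,\infty[}(p+r)^{-1}\,\mathbf M(r)\,\mu(dr)\qquad(\Re p\ge 0)$$ with a positive semi-definite real symmetric matrix $\mathbf B$, a positive measure $\mu$ with $\int_{]0,\infty[}(1+r)^{-1}\mu(dr)<\infty$ and a $\mu$-measurable function $\mathbf M$ whose values are, $\mu$-almost everywhere, positive semi-definite real symmetric matrices of operator norm at most $1$, then $\mathbf B=\mathbf B_{\mathbf n}$ and the integral term (the second summand) is $\mathrm o(p)$ as $|p|\to\infty$ in $\Re p\ge 0$. 4. $\lim_{\omega\to\infty}\omega^{-1}\mathbf A_{\mathbf n}(\omega)=0$, i.e. the attenuation grows sublinearly. 5. $\lim_{\omega\to\infty}\mathbf C_{\mathbf n}(\omega)=\mathbf B_{\mathbf n}$. -/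

import Mathlib

open Filter Topology Asymptotics MeasureTheory
open scoped Matrix Matrix.Norms.L2Operator ComplexStarModule

namespace Viscoelastic

/-- Components `C i j k l` of a rank-4 tensor over `ℝ^d`. -/
abbrev Tensor4 (d : ℕ) : Type := Fin d → Fin d → Fin d → Fin d → ℝ

/-- `C` is the component array of a symmetric operator `E ↦ C i j k l * E k l` on the space of
real symmetric `d × d` matrices with the scalar product `E i j * F i j`. -/
def IsSymmetricOperator {d : ℕ} (C : Tensor4 d) : Prop :=
  ∀ i j k l, C i j k l = C j i k l ∧ C i j k l = C i j l k ∧ C i j k l = C k l i j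

/-- The quadratic form `⟨E, C E⟩ = E i j * C i j k l * E k l`. -/
def quadForm {d : ℕ} (C : Tensor4 d) (E : Matrix (Fin d) (Fin d) ℝ) : ℝ :=
  ∑ i, ∑ j, ∑ k, ∑ l, E i j * C i j k l * E k l

/-- `C` is positive definite as an operator on the space of real symmetric matrices. -/
def IsPosDefOperator {d : ℕ} (C : Tensor4 d) : Prop :=
  ∀ E : Matrix (Fin d) (Fin d) ℝ, E.IsSymm → E ≠ 0 → 0 < quadForm C E

/-- Complete monotonicity of a real function on `]0, ∞[`. -/
def IsCompletelyMonotonic (f : ℝ → ℝ) : Prop :=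
  ContDiffOn ℝ (⊤ : ℕ∞) f (Set.Ioi 0) ∧
    ∀ (m : ℕ) (t : ℝ), 0 < t → 0 ≤ (-1) ^ m * iteratedDeriv m f t

/-- A function on `]0, ∞[` with values in the symmetric operators on the real symmetric matrices
is completely monotonic if all its quadratic forms are. -/
def IsCompletelyMonotonicTensor {d : ℕ} (G : ℝ → Tensor4 d) : Prop :=
  (∀ t, 0 < t → IsSymmetricOperator (G t)) ∧
    ∀ E : Matrix (Fin d) (Fin d) ℝ, E.IsSymm →
      IsCompletelyMonotonic (fun t => quadForm (G t) E)

/-- The components of `p ∫₀^∞ exp (-p t) G(t) dt`, for `Re p > 0`. -/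
noncomputable def laplaceModulus {d : ℕ} (G : ℝ → Tensor4 d) (p : ℂ) :
    Fin d → Fin d → Fin d → Fin d → ℂ :=
  fun i j k l => p * ∫ t in Set.Ioi (0 : ℝ), Complex.exp (-p * t) * (G t i j k l : ℂ)

/-- The complex modulus `Q(p)` on the closed half-plane `Re p ≥ 0`: the function
`p ∫₀^∞ exp (-p t) G(t) dt` on `Re p > 0`, extended by continuity to the imaginary axis (where the
Laplace integral itself does not converge if `G` has a nonzero limit at infinity). If
`G(t) = ∫ exp (-r t) H(r) ν(dr)`, then this is `p ∫ (p + r)⁻¹ H(r) ν(dr)`. -/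
noncomputable def complexModulus {d : ℕ} (G : ℝ → Tensor4 d) :
    ℂ → Fin d → Fin d → Fin d → Fin d → ℂ :=
  extendFrom {p : ℂ | 0 < p.re} (laplaceModulus G)

/-- The matrix `C i j k l * n j * n l` (with rows `i` and columns `k`). -/
noncomputable def acousticMatrix {d : ℕ} (C : Fin d → Fin d → Fin d → Fin d → ℂ)
    (n : EuclideanSpace ℝ (Fin d)) : Matrix (Fin d) (Fin d) ℂ :=
  Matrix.of fun i k => ∑ j, ∑ l, C i j k l * (n j : ℂ) * (n l : ℂ)

/-- `Y` is the principal square root of `B`: its eigenvalues lie in the open right half-plane. -/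
def IsPrincipalSqrt {d : ℕ} (B Y : Matrix (Fin d) (Fin d) ℂ) : Prop :=
  Y * Y = B ∧ ∀ z ∈ spectrum ℂ Y, 0 < z.re

open Classical in
/-- The principal square root of a complex matrix. It exists and is unique if no eigenvalue of the
matrix is a non-positive real number. -/
noncomputable def principalSqrt {d : ℕ} (B : Matrix (Fin d) (Fin d) ℂ) :
    Matrix (Fin d) (Fin d) ℂ :=
  if h : ∃ Y, IsPrincipalSqrt B Y then h.choose else 0

/-- `K_n(p) = ρ^{1/2} p Q_n(p)^{-1/2}`. -/
noncomputable def waveMatrix {d : ℕ} (ρ : ℝ) (G : ℝ → Tensor4 d) (n : EuclideanSpace ℝ (Fin d))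
    (p : ℂ) : Matrix (Fin d) (Fin d) ℂ :=
  ((√ρ : ℂ) * p) • (principalSqrt (acousticMatrix (complexModulus G p) n))⁻¹

/-- `ρ^{-1} G⁰_n`, the acoustic matrix of the instantaneous modulus divided by the density. -/
noncomputable def instantAcousticMatrix {d : ℕ} (ρ : ℝ) (G0 : Tensor4 d)
    (n : EuclideanSpace ℝ (Fin d)) : Matrix (Fin d) (Fin d) ℂ :=
  (ρ : ℂ)⁻¹ • acousticMatrix (fun i j k l => (G0 i j k l : ℂ)) n

/-- `B_n = (ρ^{-1} G⁰_n)^{-1/2}`. -/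
noncomputable def wavefrontMatrix {d : ℕ} (ρ : ℝ) (G0 : Tensor4 d)
    (n : EuclideanSpace ℝ (Fin d)) : Matrix (Fin d) (Fin d) ℂ :=
  (principalSqrt (instantAcousticMatrix ρ G0 n))⁻¹

/-- The attenuation function `A_n(ω) = Re K_n(-iω)`, where `Re B = (B + B†) / 2`. -/
noncomputable def attenuation {d : ℕ} (ρ : ℝ) (G : ℝ → Tensor4 d) (n : EuclideanSpace ℝ (Fin d))
    (ω : ℝ) : Matrix (Fin d) (Fin d) ℂ :=
  (ℜ (waveMatrix ρ G n (-Complex.I * ω)) : Matrix (Fin d) (Fin d) ℂ)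

/-- The inverse phase speed `C_n(ω) = Re [K_n(-iω) / (-iω)]`. -/
noncomputable def inversePhaseSpeed {d : ℕ} (ρ : ℝ) (G : ℝ → Tensor4 d)
    (n : EuclideanSpace ℝ (Fin d)) (ω : ℝ) : Matrix (Fin d) (Fin d) ℂ :=
  (ℜ ((-Complex.I * ω)⁻¹ • waveMatrix ρ G n (-Complex.I * ω)) : Matrix (Fin d) (Fin d) ℂ)

/-- The term `p ∫_{]0,∞[} (p + r)⁻¹ M(r) μ(dr)`. -/
noncomputable def cbfIntegral {d : ℕ} (μ : Measure ℝ) (M : ℝ → Matrix (Fin d) (Fin d) ℝ)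
    (p : ℂ) : Matrix (Fin d) (Fin d) ℂ :=
  p • ∫ r in Set.Ioi (0 : ℝ), (p + (r : ℂ))⁻¹ • (M r).map Complex.ofReal ∂μ

/-- `(B, μ, M)` is an integral representation of the matrix-valued complete Bernstein function `K`
with `K(0) = 0` on the closed right half-plane:
`K(p) = p B + p ∫_{]0,∞[} (p + r)⁻¹ M(r) μ(dr)` with `B ≥ 0`, `∫ (1 + r)⁻¹ μ(dr) < ∞`,
and `M` measurable, positive semi-definite and bounded by `1`, `μ`-almost everywhere. -/
structure IsCBFRepresentation {d : ℕ} (K : ℂ → Matrix (Fin d) (Fin d) ℂ)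
    (B : Matrix (Fin d) (Fin d) ℝ) (μ : Measure ℝ) (M : ℝ → Matrix (Fin d) (Fin d) ℝ) : Prop where
  posSemidef : B.PosSemidef
  integrable : IntegrableOn (fun r : ℝ => (1 + r)⁻¹) (Set.Ioi 0) μ
  measurable : AEStronglyMeasurable M (μ.restrict (Set.Ioi 0))
  posSemidef_ae : ∀ᵐ r ∂μ.restrict (Set.Ioi 0), (M r).PosSemidef
  norm_le_ae : ∀ᵐ r ∂μ.restrict (Set.Ioi 0), ‖M r‖ ≤ 1
  eq_on : ∀ p : ℂ, 0 ≤ p.re → K p = p • B.map Complex.ofReal + cbfIntegral μ M p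

/-- The filter `|p| → ∞` in the closed half-plane `Re p ≥ 0`. -/
noncomputable def atInftyRight : Filter ℂ := Bornology.cobounded ℂ ⊓ 𝓟 {p : ℂ | 0 ≤ p.re}

end Viscoelastic

/-!
Everything follows from `Q(p) → G⁰` as `|p| → ∞` in the closed right half-plane, uniformly in the
direction.

For a completely monotonic `f` with `f(0+) = a`, integration by parts gives
`p ∫ exp (-p t) f(t) dt = a + ∫ exp (-p t) f'(t) dt` for `Re p > 0`
(`IsRelaxation.mul_laplace_eq`). Since `f` is monotonic and bounded, `f'` is integrable on `]0, ∞[`,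
so that the right-hand side is the continuous extension to `Re p ≥ 0`. The last integral is at most
`(a - f(δ)) + 2 |f'(δ)| / |p|` for every `δ > 0` (`IsRelaxation.norm_integral_deriv_le`): the first
term bounds the integral over `]0, δ]`, the second comes from another integration by parts over
`]δ, ∞[`, in which `f'' ≥ 0`. Hence the transform tends to `a`. No integral representation of `f` is
needed. Polarization carries this over to the components of the modulus
(`IsCompletelyMonotonicTensor.tendsto_complexModulus`).

As `G⁰ ≥ G^∞`, the matrix `G⁰_n` is positive definite. The principal square root is continuous at it
(`IsPrincipalSqrt.continuousAt`): by the inverse function theorem squaring has a continuous local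
inverse, and the principal root is unique, both because the Sylvester equation `Y X + X Z = 0` has
only the zero solution if the spectra of `Y` and `Z` lie in the open right half-plane. Therefore
`K_n(p) / p = ρ^{1/2} Q_n(p)^{-1/2}` tends to `B_n` (`tendsto_slownessMatrix`).

The statements on attenuation and phase speed are the Hermitian parts of this limit along the
imaginary axis, where `B_n` is Hermitian. In an integral representation, the integral divided by `p`
tends to zero by dominated convergence (`tendsto_integral_inv_add_smul`), and comparing limits of
`K_n(p) / p` identifies the linear coefficient.
-/

namespace Viscoelastic

open scoped ComplexOrder MatrixOrder

/-! ### Principal square roots of matrices -/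

/-- Uniqueness in the Sylvester equation: the characteristic polynomial of `Y` annihilates `Y`,
while its value at `-Z` is invertible since no eigenvalue of `Y` is one of `-Z`. -/
theorem eq_zero_of_mul_add_mul_eq_zero {d : ℕ} {X Y Z : Matrix (Fin d) (Fin d) ℂ}
    (hY : ∀ z ∈ spectrum ℂ Y, 0 < z.re) (hZ : ∀ z ∈ spectrum ℂ Z, 0 < z.re)
    (h : Y * X + X * Z = 0) : X = 0 := by
  rcases Nat.eq_zero_or_pos d with rfl | hd
  · exact Subsingleton.elim _ _
  have : NeZero d := ⟨hd.ne'⟩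
  have hcomm : Y * X = X * (-Z) := by
    rw [mul_neg]; exact eq_neg_of_add_eq_zero_left h
  have hpoly (q : Polynomial ℂ) : Polynomial.aeval Y q * X = X * Polynomial.aeval (-Z) q := by
    induction q using Polynomial.induction_on with
    | C a => simp [Algebra.commutes]
    | add p q hp hq => simp [add_mul, mul_add, hp, hq]
    | monomial k a ih =>
      have e (W : Matrix (Fin d) (Fin d) ℂ) :
          Polynomial.aeval W (Polynomial.C a * Polynomial.X ^ (k + 1))
            = Polynomial.aeval W (Polynomial.C a * Polynomial.X ^ k) * W := by
        simp [pow_succ, mul_assoc]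
      rw [e, e, mul_assoc, hcomm, ← mul_assoc, ih, mul_assoc]
  have hunit : IsUnit (Polynomial.aeval (-Z) Y.charpoly) := by
    rw [← spectrum.zero_notMem_iff ℂ, spectrum.map_polynomial_aeval_of_nonempty _ _
      (spectrum.nonempty_of_isAlgClosed_of_finiteDimensional ℂ _)]
    rintro ⟨z, hz, hz0⟩
    have h1 : z ∈ spectrum ℂ Y := Matrix.mem_spectrum_iff_isRoot_charpoly.2 hz0
    have h2 : -z ∈ spectrum ℂ Z := by
      rw [← spectrum.neg_eq] at hz
      simpa using hz
    have := hY z h1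
    have := hZ _ h2
    simp at this
    linarith
  have h0 : X * Polynomial.aeval (-Z) Y.charpoly = 0 := by
    rw [← hpoly, Matrix.aeval_self_charpoly, zero_mul]
  exact hunit.mul_left_eq_zero.1 h0

theorem IsPrincipalSqrt.unique {d : ℕ} {B Y Z : Matrix (Fin d) (Fin d) ℂ}
    (hY : IsPrincipalSqrt B Y) (hZ : IsPrincipalSqrt B Z) : Y = Z := by
  refine sub_eq_zero.1 (eq_zero_of_mul_add_mul_eq_zero hY.2 hZ.2 ?_)
  rw [mul_sub, sub_mul, hY.1, hZ.1]
  abel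

theorem principalSqrt_eq {d : ℕ} {B Y : Matrix (Fin d) (Fin d) ℂ}
    (hY : IsPrincipalSqrt B Y) : principalSqrt B = Y := by
  have h : ∃ Y, IsPrincipalSqrt B Y := ⟨Y, hY⟩
  rw [principalSqrt, dif_pos h]
  exact h.choose_spec.unique hY

theorem re_pos_of_mem_spectrum_of_posDef {d : ℕ} {Y : Matrix (Fin d) (Fin d) ℂ}
    (hY : Y.PosDef) {z : ℂ} (hz : z ∈ spectrum ℂ Y) : 0 < z.re := by
  rw [← Matrix.spectrum_toLin', ← Module.End.hasEigenvalue_iff_mem_spectrum] at hz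
  obtain ⟨v, hv⟩ := hz.exists_hasEigenvector
  have hYv : Y *ᵥ v = z • v := by simpa using hv.apply_eq_smul
  have h1 := hY.dotProduct_mulVec_pos hv.2
  rw [hYv, dotProduct_smul, smul_eq_mul] at h1
  have h3 : 0 < star v ⬝ᵥ v := Matrix.dotProduct_star_self_pos_iff.2 hv.2
  exact (Complex.lt_def.1 ((pos_iff_pos_of_mul_pos h1).2 h3)).1

theorem exists_posDef_mul_self_eq {d : ℕ} {A : Matrix (Fin d) (Fin d) ℝ} (hA : A.PosDef) :
    ∃ S : Matrix (Fin d) (Fin d) ℝ, S.PosDef ∧ S * S = A := by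
  have hS : CFC.sqrt A * CFC.sqrt A = A := CFC.sqrt_mul_sqrt_self A hA.posSemidef.nonneg
  have hS0 : (CFC.sqrt A).PosSemidef := Matrix.nonneg_iff_posSemidef.1 (CFC.sqrt_nonneg A)
  refine ⟨CFC.sqrt A, hS0.posDef_iff_isUnit.2 ?_, hS⟩
  have := hA.isUnit
  rw [← hS] at this
  exact ((Commute.refl _).isUnit_mul_iff.1 this).1

/-- A square root turns the claim into one on `Tᴴ T` with `T` invertible, which is positive definite
over the complex numbers as well. -/
theorem posDef_map_ofReal {d : ℕ} {A : Matrix (Fin d) (Fin d) ℝ} (hA : A.PosDef) :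
    (A.map Complex.ofReal).PosDef := by
  obtain ⟨S, hS, rfl⟩ := exists_posDef_mul_self_eq hA
  have h : (S * S).map Complex.ofReal = (S.map Complex.ofReal)ᴴ * S.map Complex.ofReal := by
    have h1 : (S.map Complex.ofReal)ᴴ = S.map Complex.ofReal := by
      rw [← Matrix.conjTranspose_map _ (fun x => (Complex.conj_ofReal x).symm), hS.isHermitian.eq]
    rw [h1]
    exact Matrix.map_mul (f := Complex.ofRealHom)
  rw [h]
  exact Matrix.PosDef.conjTranspose_mul_self _
    (Matrix.mulVec_injective_iff_isUnit.2 (hS.isUnit.map Complex.ofRealHom.mapMatrix))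

theorem isPrincipalSqrt_map_ofReal {d : ℕ} {S : Matrix (Fin d) (Fin d) ℝ} (hS : S.PosDef) :
    IsPrincipalSqrt ((S * S).map Complex.ofReal) (S.map Complex.ofReal) :=
  ⟨(Matrix.map_mul (f := Complex.ofRealHom)).symm,
    fun _ hz => re_pos_of_mem_spectrum_of_posDef (posDef_map_ofReal hS) hz⟩

/-- The principal square root is continuous where it exists: squaring is a local diffeomorphism at
such a root because its derivative there is a Sylvester operator, and nearby roots remain principal
because the spectrum is upper hemicontinuous. -/
theorem IsPrincipalSqrt.continuousAt {d : ℕ} {A S : Matrix (Fin d) (Fin d) ℂ}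
    (h : IsPrincipalSqrt A S) : ContinuousAt principalSqrt A := by
  have hcomplete : CompleteSpace (Matrix (Fin d) (Fin d) ℂ) := FiniteDimensional.complete ℂ _
  let D : Matrix (Fin d) (Fin d) ℂ →L[ℂ] Matrix (Fin d) (Fin d) ℂ :=
    S • ContinuousLinearMap.id ℂ _ + MulOpposite.op S • ContinuousLinearMap.id ℂ _
  have hD : HasStrictFDerivAt (fun Y : Matrix (Fin d) (Fin d) ℂ => Y * Y) D S :=
    (hasStrictFDerivAt_id S).mul' (hasStrictFDerivAt_id S)
  have hinj : Function.Injective D := by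
    rw [injective_iff_map_eq_zero]
    intro X hX
    exact eq_zero_of_mul_add_mul_eq_zero h.2 h.2 hX
  let e : Matrix (Fin d) (Fin d) ℂ ≃L[ℂ] Matrix (Fin d) (Fin d) ℂ :=
    (LinearEquiv.ofInjectiveEndo D.toLinearMap hinj).toContinuousLinearEquiv
  have he : (e : Matrix (Fin d) (Fin d) ℂ →L[ℂ] Matrix (Fin d) (Fin d) ℂ) = D := by
    ext1 X; rfl
  rw [← he] at hD
  have h1 := hD.eventually_right_inverse
  have h2 := hD.localInverse_continuousAt
  have h3 : hD.localInverse _ _ _ (S * S) = S := hD.localInverse_apply_image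
  rw [h.1] at h1 h2 h3
  have hopen : IsOpen {z : ℂ | 0 < z.re} := isOpen_lt continuous_const Complex.continuous_re
  have h4 : ∀ᶠ Y in 𝓝 S, ∀ z ∈ spectrum ℂ Y, 0 < z.re := by
    exact upperHemicontinuousAt_iff_forall_isOpen.1
      (upperHemicontinuous_spectrum ℂ (Matrix (Fin d) (Fin d) ℂ) S) _ hopen h.2
  have h5 : hD.localInverse _ _ _ =ᶠ[𝓝 A] principalSqrt := by
    have h6 := h2.tendsto
    rw [h3] at h6
    filter_upwards [h1, h6.eventually h4] with B hB1 hB2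
    exact (principalSqrt_eq ⟨hB1, hB2⟩).symm
  exact h2.congr h5

/-! ### Laplace transforms of completely monotonic functions -/

/-- The part of complete monotonicity that the Laplace transform needs: on `]0, ∞[` the function `f`
has derivatives `f₁ ≤ 0` and `f₂ ≥ 0`, the latter continuous, with limits `a` at `0+` and `b` at
`∞`. -/
structure IsRelaxation (f f₁ f₂ : ℝ → ℝ) (a b : ℝ) : Prop where
  hasDerivAt : ∀ t, 0 < t → HasDerivAt f (f₁ t) t
  hasDerivAt₁ : ∀ t, 0 < t → HasDerivAt f₁ (f₂ t) t
  continuousOn₂ : ContinuousOn f₂ (Set.Ioi 0)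
  nonpos₁ : ∀ t, 0 < t → f₁ t ≤ 0
  nonneg₂ : ∀ t, 0 < t → 0 ≤ f₂ t
  tendsto_zero : Tendsto f (𝓝[>] 0) (𝓝 a)
  tendsto_top : Tendsto f atTop (𝓝 b)

theorem IsCompletelyMonotonic.isRelaxation {f : ℝ → ℝ} (hf : IsCompletelyMonotonic f) {a b : ℝ}
    (ha : Tendsto f (𝓝[>] 0) (𝓝 a)) (hb : Tendsto f atTop (𝓝 b)) :
    IsRelaxation f (deriv f) (deriv (deriv f)) a b := by
  have ho : IsOpen (Set.Ioi (0 : ℝ)) := isOpen_Ioi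
  have h1 : ContDiffOn ℝ (⊤ : ℕ∞) (deriv f) (Set.Ioi 0) := hf.1.deriv_of_isOpen ho (by simp)
  have h2 : ContDiffOn ℝ (⊤ : ℕ∞) (deriv (deriv f)) (Set.Ioi 0) := h1.deriv_of_isOpen ho (by simp)
  refine ⟨fun t ht => ?_, fun t ht => ?_, h2.continuousOn, fun t ht => ?_, fun t ht => ?_, ha, hb⟩
  · exact ((hf.1.differentiableOn (by simp)).differentiableAt (ho.mem_nhds ht)).hasDerivAt
  · exact ((h1.differentiableOn (by simp)).differentiableAt (ho.mem_nhds ht)).hasDerivAt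
  · simpa using hf.2 1 t ht
  · simpa [iteratedDeriv_succ] using hf.2 2 t ht

namespace IsRelaxation

variable {f f₁ f₂ : ℝ → ℝ} {a b : ℝ} (h : IsRelaxation f f₁ f₂ a b)
include h

theorem antitoneOn : AntitoneOn f (Set.Ioi 0) := by
  refine antitoneOn_of_deriv_nonpos (convex_Ioi 0)
    (fun t ht => (h.hasDerivAt t ht).continuousAt.continuousWithinAt) ?_ ?_
  · intro t ht
    rw [interior_Ioi] at ht
    exact (h.hasDerivAt t ht).differentiableAt.differentiableWithinAt
  · intro t ht
    rw [interior_Ioi] at ht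
    rw [(h.hasDerivAt t ht).deriv]
    exact h.nonpos₁ t ht

theorem le_left {t : ℝ} (ht : 0 < t) : f t ≤ a := by
  refine ge_of_tendsto h.tendsto_zero ?_
  filter_upwards [Ioo_mem_nhdsGT ht] with s hs
  exact h.antitoneOn hs.1 ht hs.2.le

theorem right_le {t : ℝ} (ht : 0 < t) : b ≤ f t := by
  refine le_of_tendsto h.tendsto_top ?_
  filter_upwards [eventually_ge_atTop t] with s hs
  exact h.antitoneOn ht (ht.trans_le hs) hs

/-- Setting `f 0 = a` makes `f` continuous at `0` from the right, as the fundamental theorem of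
calculus on `[0, ∞[` requires. -/
theorem continuousWithinAt_update : ContinuousWithinAt (Function.update f 0 a) (Set.Ici 0) 0 := by
  rw [continuousWithinAt_update_same]
  simpa using h.tendsto_zero

theorem hasDerivAt_update {t : ℝ} (ht : 0 < t) : HasDerivAt (Function.update f 0 a) (f₁ t) t := by
  refine (h.hasDerivAt t ht).congr_of_eventuallyEq ?_
  filter_upwards [isOpen_Ioi.mem_nhds ht] with s hs
  exact Function.update_of_ne (ne_of_gt hs) _ _

theorem tendsto_update : Tendsto (Function.update f 0 a) atTop (𝓝 b) := by
  refine h.tendsto_top.congr' ?_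
  filter_upwards [eventually_gt_atTop 0] with s hs
  exact (Function.update_of_ne hs.ne' _ _).symm

theorem integrableOn_deriv : IntegrableOn f₁ (Set.Ioi 0) :=
  integrableOn_Ioi_deriv_of_nonpos h.continuousWithinAt_update
    (fun _ ht => h.hasDerivAt_update ht) h.nonpos₁ h.tendsto_update

theorem integral_Ioc_deriv {δ : ℝ} (hδ : 0 < δ) : ∫ t in Set.Ioc 0 δ, f₁ t = f δ - a := by
  have h1 := integral_Ioi_of_hasDerivAt_of_nonpos h.continuousWithinAt_update
    (fun _ ht => h.hasDerivAt_update ht) h.nonpos₁ h.tendsto_update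
  have h2 := integral_Ioi_of_hasDerivAt_of_nonpos' (a := δ)
    (fun t ht => h.hasDerivAt t (hδ.trans_le ht)) (fun t ht => h.nonpos₁ t (hδ.trans ht))
    h.tendsto_top
  rw [← Set.Ioc_union_Ioi_eq_Ioi hδ.le, setIntegral_union Set.Ioc_disjoint_Ioi_same
    measurableSet_Ioi (h.integrableOn_deriv.mono_set Set.Ioc_subset_Ioi_self)
    (h.integrableOn_deriv.mono_set (Set.Ioi_subset_Ioi hδ.le)), h2, Function.update_self] at h1
  linarith

end IsRelaxation

theorem norm_exp_neg_mul_le_one {p : ℂ} (hp : 0 ≤ p.re) {t : ℝ} (ht : 0 ≤ t) :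
    ‖Complex.exp (-p * t)‖ ≤ 1 := by
  rw [Complex.norm_exp, Real.exp_le_one_iff]
  simpa using mul_nonneg hp ht

theorem integrableOn_exp_mul {p : ℂ} (hp : 0 ≤ p.re) {g : ℝ → ℝ} {s : Set ℝ}
    (hs : MeasurableSet s) (hs0 : s ⊆ Set.Ioi 0) (hg : IntegrableOn g s) :
    IntegrableOn (fun t : ℝ => Complex.exp (-p * t) * (g t : ℂ)) s := by
  refine Integrable.mono' hg.norm ?_ ?_
  · exact (Continuous.aestronglyMeasurable (by fun_prop)).mul hg.ofReal.aestronglyMeasurable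
  · filter_upwards [ae_restrict_mem hs] with t ht
    rw [norm_mul, Complex.norm_real]
    exact mul_le_of_le_one_left (norm_nonneg _) (norm_exp_neg_mul_le_one hp (hs0 ht).le)

theorem hasDerivAt_exp_neg_mul (p : ℂ) (t : ℝ) :
    HasDerivAt (fun t : ℝ => Complex.exp (-p * t)) (Complex.exp (-p * t) * (-p)) t := by
  have h1 : HasDerivAt (fun t : ℝ => -p * (t : ℂ)) (-p) t := by
    simpa using (Complex.ofRealCLM.hasDerivAt (x := t)).const_mul (-p)
  exact h1.cexp

namespace IsRelaxation

variable {f f₁ f₂ : ℝ → ℝ} {a b : ℝ} (h : IsRelaxation f f₁ f₂ a b)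
include h

theorem norm_le {t : ℝ} (ht : 0 < t) : ‖f t‖ ≤ |a| + |b| := by
  have h1 := h.le_left ht
  have h2 := h.right_le ht
  rw [Real.norm_eq_abs, abs_le]
  constructor <;> linarith [le_abs_self a, neg_abs_le b, abs_nonneg a, abs_nonneg b]

theorem integrableOn_laplace {p : ℂ} (hp : 0 < p.re) :
    IntegrableOn (fun t : ℝ => Complex.exp (-p * t) * (f t : ℂ)) (Set.Ioi 0) := by
  have hc : ContinuousOn (fun t : ℝ => Complex.exp (-p * t) * (f t : ℂ)) (Set.Ioi 0) := by
    refine ContinuousOn.mul (by fun_prop) fun t ht => ?_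
    exact (Complex.continuous_ofReal.continuousAt.comp
      (h.hasDerivAt t ht).continuousAt).continuousWithinAt
  refine Integrable.mono' (g := fun t => Real.exp (-p.re * t) * (|a| + |b|))
    ((integrableOn_exp_mul_Ioi (neg_lt_zero.2 hp) 0).mul_const _)
    (hc.aestronglyMeasurable measurableSet_Ioi) ?_
  filter_upwards [ae_restrict_mem measurableSet_Ioi] with t ht
  rw [norm_mul, Complex.norm_real, Complex.norm_exp]
  have : (-p * (t : ℂ)).re = -p.re * t := by simp
  rw [this]
  exact mul_le_mul_of_nonneg_left (h.norm_le ht) (Real.exp_nonneg _)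

/-- Integration by parts removes the pole at the origin: the right-hand side makes sense, and is
continuous, on the closed half-plane. -/
theorem mul_laplace_eq {p : ℂ} (hp : 0 < p.re) :
    p * ∫ t in Set.Ioi (0 : ℝ), Complex.exp (-p * t) * (f t : ℂ)
      = a + ∫ t in Set.Ioi (0 : ℝ), Complex.exp (-p * t) * (f₁ t : ℂ) := by
  have hexp : Tendsto (fun t : ℝ => Complex.exp (-p * t)) atTop (𝓝 0) := by
    rw [tendsto_zero_iff_norm_tendsto_zero]
    have : (fun t : ℝ => ‖Complex.exp (-p * t)‖) = fun t => Real.exp (-(p.re * t)) := by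
      ext t; simp [Complex.norm_exp]
    rw [this]
    exact Real.tendsto_exp_neg_atTop_nhds_zero.comp (tendsto_id.const_mul_atTop hp)
  have key := integral_Ioi_mul_deriv_eq_deriv_mul (a := 0) (a' := -(a : ℂ)) (b' := 0)
    (u := fun t => (f t : ℂ)) (u' := fun t => (f₁ t : ℂ))
    (v := fun t => -Complex.exp (-p * t)) (v' := fun t => p * Complex.exp (-p * t))
    (fun t ht => (h.hasDerivAt t ht).ofReal_comp)
    (fun t _ => by
      have := (hasDerivAt_exp_neg_mul p t).neg
      rwa [mul_neg, neg_neg, mul_comm] at this)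
    (by
      refine ((h.integrableOn_laplace hp).const_mul p).congr (ae_of_all _ fun t => ?_)
      simp only [Pi.mul_apply]; ring)
    (by
      refine (integrableOn_exp_mul hp.le measurableSet_Ioi subset_rfl
        h.integrableOn_deriv).neg.congr (ae_of_all _ fun t => ?_)
      simp only [Pi.mul_apply, Pi.neg_apply]; ring)
    (by
      have h1 : Tendsto (fun t : ℝ => -Complex.exp (-p * t)) (𝓝[>] 0) (𝓝 (-1)) := by
        have : Continuous fun t : ℝ => -Complex.exp (-p * t) := by fun_prop
        simpa using (this.tendsto 0).mono_left nhdsWithin_le_nhds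
      have h2 := ((Complex.continuous_ofReal.tendsto a).comp h.tendsto_zero).mul h1
      rw [mul_neg_one] at h2
      exact h2)
    (by
      have h2 := ((Complex.continuous_ofReal.tendsto b).comp h.tendsto_top).mul hexp.neg
      rw [neg_zero, mul_zero] at h2
      exact h2)
  rw [← integral_const_mul]
  have e1 : ∀ t : ℝ, p * (Complex.exp (-p * t) * (f t : ℂ)) = f t * (p * Complex.exp (-p * t)) :=
    fun t => by ring
  have e2 : ∀ t : ℝ, (f₁ t : ℂ) * -Complex.exp (-p * t) = -(Complex.exp (-p * t) * f₁ t) :=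
    fun t => by ring
  simp_rw [e1, key, e2, integral_neg]
  ring

/-- The extension of `p ∫ exp (-p t) f(t) dt` to the imaginary axis by continuity. -/
theorem tendsto_mul_laplace (p : ℂ) :
    Tendsto (fun q : ℂ => q * ∫ t in Set.Ioi (0 : ℝ), Complex.exp (-q * t) * (f t : ℂ))
      (𝓝[{q : ℂ | 0 < q.re}] p)
      (𝓝 (a + ∫ t in Set.Ioi (0 : ℝ), Complex.exp (-p * t) * (f₁ t : ℂ))) := by
  have h1 : Tendsto
      (fun q : ℂ => (a : ℂ) + ∫ t in Set.Ioi (0 : ℝ), Complex.exp (-q * t) * (f₁ t : ℂ))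
      (𝓝[{q : ℂ | 0 < q.re}] p)
      (𝓝 (a + ∫ t in Set.Ioi (0 : ℝ), Complex.exp (-p * t) * (f₁ t : ℂ))) := by
    refine tendsto_const_nhds.add (tendsto_integral_filter_of_dominated_convergence
      (fun t => ‖f₁ t‖) ?_ ?_ h.integrableOn_deriv.norm ?_)
    · filter_upwards [self_mem_nhdsWithin] with q hq
      exact (integrableOn_exp_mul (le_of_lt hq) measurableSet_Ioi subset_rfl
        h.integrableOn_deriv).aestronglyMeasurable
    · filter_upwards [self_mem_nhdsWithin] with q hq
      filter_upwards [ae_restrict_mem measurableSet_Ioi] with t ht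
      rw [norm_mul, Complex.norm_real]
      exact mul_le_of_le_one_left (norm_nonneg _)
        (norm_exp_neg_mul_le_one (le_of_lt hq) (le_of_lt ht))
    · refine ae_of_all _ fun t => ?_
      have : Continuous fun q : ℂ => Complex.exp (-q * t) * (f₁ t : ℂ) := by fun_prop
      exact (this.tendsto p).mono_left nhdsWithin_le_nhds
  refine h1.congr' ?_
  filter_upwards [self_mem_nhdsWithin] with q hq
  exact (h.mul_laplace_eq hq).symm

/-- Away from the origin, a second integration by parts and the convexity of `f` give decay in
`p`, uniformly in the closed half-plane. -/
theorem norm_integral_Ioi_le {p : ℂ} (hp : 0 ≤ p.re) (hp0 : p ≠ 0) {δ : ℝ} (hδ : 0 < δ) :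
    ‖∫ t in Set.Ioi δ, Complex.exp (-p * t) * (f₁ t : ℂ)‖ ≤ -2 * f₁ δ / ‖p‖ := by
  have hint : IntegrableOn (fun t : ℝ => Complex.exp (-p * t) * (f₁ t : ℂ)) (Set.Ioi δ) :=
    integrableOn_exp_mul hp measurableSet_Ioi (Set.Ioi_subset_Ioi hδ.le)
      (h.integrableOn_deriv.mono_set (Set.Ioi_subset_Ioi hδ.le))
  refine le_of_tendsto (intervalIntegral_tendsto_integral_Ioi δ hint tendsto_id).norm ?_
  -- on `[δ, T]` the boundary terms and the mass of `f₂` add up to a bound that does not involve `T`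
  filter_upwards [eventually_ge_atTop δ] with T hT
  have hsub : Set.uIcc δ T ⊆ Set.Ioi 0 := by
    rw [Set.uIcc_of_le hT]
    exact fun t ht => hδ.trans_le ht.1
  have hf₂ : IntervalIntegrable f₂ volume δ T := (h.continuousOn₂.mono hsub).intervalIntegrable
  have hFTC : ∫ t in δ..T, f₂ t = f₁ T - f₁ δ :=
    intervalIntegral.integral_eq_sub_of_hasDerivAt (fun t ht => h.hasDerivAt₁ t (hsub ht)) hf₂
  have hc : Continuous fun t : ℝ => Complex.exp (-p * t) := by fun_prop
  have key := intervalIntegral.integral_mul_deriv_eq_deriv_mul (a := δ) (b := T)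
    (u := fun t => (f₁ t : ℂ)) (u' := fun t => (f₂ t : ℂ))
    (v := fun t => -p⁻¹ * Complex.exp (-p * t)) (v' := fun t => Complex.exp (-p * t))
    (fun t ht => (h.hasDerivAt₁ t (hsub ht)).ofReal_comp)
    (fun t _ => by
      convert (hasDerivAt_exp_neg_mul p t).const_mul (-p⁻¹) using 1
      field_simp)
    ⟨hf₂.1.ofReal, hf₂.2.ofReal⟩ (hc.intervalIntegrable _ _)
  have hv : ∀ t : ℝ, 0 < t → ‖-p⁻¹ * Complex.exp (-p * t)‖ ≤ ‖p‖⁻¹ := fun t ht => by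
    rw [norm_mul, norm_neg, norm_inv]
    exact mul_le_of_le_one_right (by positivity) (norm_exp_neg_mul_le_one hp ht.le)
  have hT0 : 0 < T := hδ.trans_le hT
  have b1 : ‖(f₁ T : ℂ) * (-p⁻¹ * Complex.exp (-p * T))‖ ≤ -f₁ T * ‖p‖⁻¹ := by
    rw [norm_mul, Complex.norm_real, Real.norm_of_nonpos (h.nonpos₁ T hT0)]
    exact mul_le_mul_of_nonneg_left (hv T hT0) (by linarith [h.nonpos₁ T hT0])
  have b2 : ‖(f₁ δ : ℂ) * (-p⁻¹ * Complex.exp (-p * δ))‖ ≤ -f₁ δ * ‖p‖⁻¹ := by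
    rw [norm_mul, Complex.norm_real, Real.norm_of_nonpos (h.nonpos₁ δ hδ)]
    exact mul_le_mul_of_nonneg_left (hv δ hδ) (by linarith [h.nonpos₁ δ hδ])
  have b3 : ‖∫ t in δ..T, (f₂ t : ℂ) * (-p⁻¹ * Complex.exp (-p * t))‖
      ≤ (f₁ T - f₁ δ) * ‖p‖⁻¹ := by
    rw [← hFTC, ← intervalIntegral.integral_mul_const]
    refine intervalIntegral.norm_integral_le_of_norm_le hT (ae_of_all _ fun t ht => ?_)
      (hf₂.mul_const _)
    have ht0 : 0 < t := hδ.trans ht.1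
    rw [norm_mul, Complex.norm_real, Real.norm_of_nonneg (h.nonneg₂ t ht0)]
    exact mul_le_mul_of_nonneg_left (hv t ht0) (h.nonneg₂ t ht0)
  simp_rw [mul_comm (Complex.exp _), id, key]
  calc _ ≤ -f₁ T * ‖p‖⁻¹ + -f₁ δ * ‖p‖⁻¹ + (f₁ T - f₁ δ) * ‖p‖⁻¹ :=
        (norm_sub_le _ _).trans (add_le_add ((norm_sub_le _ _).trans (add_le_add b1 b2)) b3)
    _ = _ := by ring

/-- Near the origin the mass of `f₁` is small, whatever `p`; on the rest `norm_integral_Ioi_le`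
applies. -/
theorem norm_integral_deriv_le {p : ℂ} (hp : 0 ≤ p.re) (hp0 : p ≠ 0) {δ : ℝ} (hδ : 0 < δ) :
    ‖∫ t in Set.Ioi (0 : ℝ), Complex.exp (-p * t) * (f₁ t : ℂ)‖
      ≤ (a - f δ) + -2 * f₁ δ / ‖p‖ := by
  have hint := integrableOn_exp_mul hp measurableSet_Ioi subset_rfl h.integrableOn_deriv
  rw [← Set.Ioc_union_Ioi_eq_Ioi hδ.le, setIntegral_union Set.Ioc_disjoint_Ioi_same
    measurableSet_Ioi (hint.mono_set Set.Ioc_subset_Ioi_self)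
    (hint.mono_set (Set.Ioi_subset_Ioi hδ.le))]
  refine (norm_add_le _ _).trans (add_le_add ?_ (h.norm_integral_Ioi_le hp hp0 hδ))
  rw [← neg_sub, ← h.integral_Ioc_deriv hδ, ← integral_neg]
  refine norm_integral_le_of_norm_le
    (h.integrableOn_deriv.mono_set Set.Ioc_subset_Ioi_self).neg ?_
  filter_upwards [ae_restrict_mem measurableSet_Ioc] with t ht
  rw [norm_mul, Complex.norm_real, Real.norm_of_nonpos (h.nonpos₁ t ht.1)]
  exact mul_le_of_le_one_left (by linarith [h.nonpos₁ t ht.1])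
    (norm_exp_neg_mul_le_one hp ht.1.le)

/-- A Riemann–Lebesgue lemma in the closed half-plane. -/
theorem tendsto_atInftyRight :
    Tendsto (fun p : ℂ => (a : ℂ) + ∫ t in Set.Ioi (0 : ℝ), Complex.exp (-p * t) * (f₁ t : ℂ))
      atInftyRight (𝓝 a) := by
  suffices H : Tendsto (fun p : ℂ => ∫ t in Set.Ioi (0 : ℝ), Complex.exp (-p * t) * (f₁ t : ℂ))
      atInftyRight (𝓝 0) by simpa using H.const_add (a : ℂ)
  rw [Metric.tendsto_nhds]
  intro ε hε
  obtain ⟨δ, hδ, hδ0⟩ := ((h.tendsto_zero.eventually_const_lt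
    (show a - ε / 2 < a by linarith)).and self_mem_nhdsWithin).exists
  have hlim : Tendsto (fun p : ℂ => -2 * f₁ δ / ‖p‖) atInftyRight (𝓝 0) :=
    tendsto_const_nhds.div_atTop (tendsto_norm_cobounded_atTop.mono_left inf_le_left)
  have hre : ∀ᶠ p in atInftyRight, 0 ≤ p.re := mem_inf_of_right (mem_principal_self _)
  have hne : ∀ᶠ p in atInftyRight, p ≠ 0 :=
    (Bornology.eventually_ne_cobounded 0).filter_mono inf_le_left
  filter_upwards [hlim.eventually_lt_const (half_pos hε), hre, hne] with p h1 h2 h3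
  rw [dist_zero_right]
  linarith [h.norm_integral_deriv_le h2 h3 hδ0]

end IsRelaxation

/-! ### Tensors and their quadratic forms -/

/-- Twice the symmetrized matrix unit with indices `i`, `j`. -/
def symUnit {d : ℕ} (i j : Fin d) : Matrix (Fin d) (Fin d) ℝ :=
  Matrix.single i j 1 + Matrix.single j i 1

theorem isSymm_symUnit {d : ℕ} (i j : Fin d) : (symUnit i j).IsSymm := by
  simp [Matrix.IsSymm, symUnit, add_comm]

/-- The value of the bilinear form of `C` at two matrices. -/
def bilinForm {d : ℕ} (C : Tensor4 d) (E F : Matrix (Fin d) (Fin d) ℝ) : ℝ :=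
  ∑ i, ∑ j, ∑ k, ∑ l, E i j * C i j k l * F k l

theorem bilinForm_single {d : ℕ} (C : Tensor4 d) (i j k l : Fin d) :
    bilinForm C (Matrix.single i j 1) (Matrix.single k l 1) = C i j k l := by
  simp [bilinForm, Matrix.single_apply, ite_and, Finset.sum_ite_eq]

theorem bilinForm_add_left {d : ℕ} (C : Tensor4 d) (E E' F : Matrix (Fin d) (Fin d) ℝ) :
    bilinForm C (E + E') F = bilinForm C E F + bilinForm C E' F := by
  simp [bilinForm, add_mul, Finset.sum_add_distrib]

theorem bilinForm_add_right {d : ℕ} (C : Tensor4 d) (E F F' : Matrix (Fin d) (Fin d) ℝ) :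
    bilinForm C E (F + F') = bilinForm C E F + bilinForm C E F' := by
  simp [bilinForm, mul_add, Finset.sum_add_distrib]

theorem quadForm_add_sub_quadForm_sub {d : ℕ} (C : Tensor4 d) (E F : Matrix (Fin d) (Fin d) ℝ) :
    quadForm C (E + F) - quadForm C (E - F) = 2 * (bilinForm C E F + bilinForm C F E) := by
  simp only [bilinForm, quadForm, ← Finset.sum_sub_distrib, ← Finset.sum_add_distrib,
    Finset.mul_sum, Matrix.add_apply, Matrix.sub_apply]
  refine Finset.sum_congr rfl fun i _ => Finset.sum_congr rfl fun j _ =>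
    Finset.sum_congr rfl fun k _ => Finset.sum_congr rfl fun l _ => ?_
  ring

theorem bilinForm_symUnit {d : ℕ} {C : Tensor4 d} (hC : IsSymmetricOperator C) (i j k l : Fin d) :
    bilinForm C (symUnit i j) (symUnit k l) = 4 * C i j k l := by
  simp only [symUnit, bilinForm_add_left, bilinForm_add_right, bilinForm_single]
  have h1 := (hC i j k l).1
  have h2 := (hC i j k l).2.1
  have h3 := (hC j i k l).2.1
  linarith

/-- Polarization: the components of a symmetric operator are determined by its quadratic form. -/
theorem IsSymmetricOperator.apply_eq {d : ℕ} {C : Tensor4 d} (hC : IsSymmetricOperator C)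
    (i j k l : Fin d) : C i j k l =
      (quadForm C (symUnit i j + symUnit k l) - quadForm C (symUnit i j - symUnit k l)) / 16 := by
  rw [quadForm_add_sub_quadForm_sub, bilinForm_symUnit hC, bilinForm_symUnit hC, ← (hC i j k l).2.2]
  ring

theorem quadForm_add_transpose {d : ℕ} {C : Tensor4 d} (hC : IsSymmetricOperator C)
    (X : Matrix (Fin d) (Fin d) ℝ) : quadForm C (X + Xᵀ) = 4 * quadForm C X := by
  have h1 (F : Matrix (Fin d) (Fin d) ℝ) : bilinForm C Xᵀ F = bilinForm C X F := by
    unfold bilinForm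
    rw [Finset.sum_comm]
    refine Finset.sum_congr rfl fun i _ => Finset.sum_congr rfl fun j _ =>
      Finset.sum_congr rfl fun k _ => Finset.sum_congr rfl fun l _ => ?_
    rw [Matrix.transpose_apply, (hC j i k l).1]
  have h2 (F : Matrix (Fin d) (Fin d) ℝ) : bilinForm C F Xᵀ = bilinForm C F X := by
    unfold bilinForm
    refine Finset.sum_congr rfl fun i _ => Finset.sum_congr rfl fun j _ => ?_
    rw [Finset.sum_comm]
    refine Finset.sum_congr rfl fun k _ => Finset.sum_congr rfl fun l _ => ?_
    rw [Matrix.transpose_apply, (hC i j l k).2.1]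
  change bilinForm C (X + Xᵀ) (X + Xᵀ) = 4 * bilinForm C X X
  simp only [bilinForm_add_left, bilinForm_add_right, h1, h2]
  ring

theorem continuous_quadForm {d : ℕ} (E : Matrix (Fin d) (Fin d) ℝ) :
    Continuous fun C : Tensor4 d => quadForm C E := by
  unfold quadForm
  fun_prop

theorem isClosed_setOf_isSymmetricOperator {d : ℕ} :
    IsClosed {C : Tensor4 d | IsSymmetricOperator C} := by
  simp only [IsSymmetricOperator, Set.ofPred_forall, Set.ofPred_and]
  refine isClosed_iInter fun i => isClosed_iInter fun j => isClosed_iInter fun k =>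
    isClosed_iInter fun l => (isClosed_eq ?_ ?_).inter ((isClosed_eq ?_ ?_).inter
      (isClosed_eq ?_ ?_)) <;> fun_prop

/-! ### Acoustic matrices -/

/-- The matrix `C i j k l * n j * n l` of a real tensor, as a real matrix. -/
def realAcousticMatrix {d : ℕ} (C : Tensor4 d) (n : EuclideanSpace ℝ (Fin d)) :
    Matrix (Fin d) (Fin d) ℝ :=
  Matrix.of fun i k => ∑ j, ∑ l, C i j k l * n j * n l

theorem map_ofReal_realAcousticMatrix {d : ℕ} (C : Tensor4 d) (n : EuclideanSpace ℝ (Fin d)) :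
    (realAcousticMatrix C n).map Complex.ofReal
      = acousticMatrix (fun i j k l => (C i j k l : ℂ)) n := by
  ext i k
  simp [realAcousticMatrix, acousticMatrix]

theorem dotProduct_realAcousticMatrix {d : ℕ} (C : Tensor4 d) (n : EuclideanSpace ℝ (Fin d))
    (v : Fin d → ℝ) :
    v ⬝ᵥ (realAcousticMatrix C n *ᵥ v) = quadForm C (Matrix.of fun i j => v i * n j) := by
  simp only [dotProduct, Matrix.mulVec, realAcousticMatrix, quadForm, Matrix.of_apply,
    Finset.mul_sum, Finset.sum_mul]
  refine Finset.sum_congr rfl fun i _ => ?_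
  rw [Finset.sum_comm]
  refine Finset.sum_congr rfl fun j _ => Finset.sum_congr rfl fun k _ =>
    Finset.sum_congr rfl fun l _ => ?_
  ring

/-- The acoustic matrix is positive definite: its quadratic form at `v` is, up to a factor, the
quadratic form of the tensor at the symmetrized product of `v` and `n`, which is not zero. -/
theorem posDef_realAcousticMatrix {d : ℕ} {C : Tensor4 d} (hC : IsSymmetricOperator C)
    (hpos : IsPosDefOperator C) {n : EuclideanSpace ℝ (Fin d)} (hn : n ≠ 0) :
    (realAcousticMatrix C n).PosDef := by
  refine Matrix.PosDef.of_dotProduct_mulVec_pos ?_ fun v hv => ?_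
  · ext i k
    simp only [Matrix.conjTranspose_apply, realAcousticMatrix, Matrix.of_apply, star_trivial]
    rw [Finset.sum_comm]
    refine Finset.sum_congr rfl fun j _ => Finset.sum_congr rfl fun l _ => ?_
    rw [(hC k l i j).2.2]
    ring
  rw [star_trivial, dotProduct_realAcousticMatrix]
  set X : Matrix (Fin d) (Fin d) ℝ := Matrix.of fun i j => v i * n j with hX
  have h0 : X + Xᵀ ≠ 0 := by
    intro h
    have hij (i j : Fin d) : v i * n j + v j * n i = 0 := by
      simpa [hX] using congrFun (congrFun h i) j
    obtain ⟨j, hj⟩ : ∃ j, n j ≠ 0 := by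
      by_contra! hall
      exact hn (by ext j; simpa using hall j)
    have hvj : v j = 0 := by
      have := hij j j
      have h2 : v j * n j = 0 := by linarith
      exact (mul_eq_zero.1 h2).resolve_right hj
    refine hv (funext fun i => ?_)
    have := hij i j
    rw [hvj, zero_mul, add_zero] at this
    exact (mul_eq_zero.1 this).resolve_right hj
  have := hpos (X + Xᵀ) (Matrix.isSymm_add_transpose_self X) h0
  rw [quadForm_add_transpose hC] at this
  linarith

theorem continuous_acousticMatrix {d : ℕ} (n : EuclideanSpace ℝ (Fin d)) :
    Continuous fun C : Fin d → Fin d → Fin d → Fin d → ℂ => acousticMatrix C n := by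
  refine continuous_matrix fun i k => ?_
  simp only [acousticMatrix, Matrix.of_apply]
  fun_prop

/-! ### The high-frequency limit of the complex modulus -/

section Modulus

variable {d : ℕ} {G : ℝ → Tensor4 d} (hG : IsCompletelyMonotonicTensor G) {G0 Ginf : Tensor4 d}
  (hG0 : Tendsto G (𝓝[>] 0) (𝓝 G0)) (hGinf : Tendsto G atTop (𝓝 Ginf))
include hG hG0

theorem IsCompletelyMonotonicTensor.isSymmetricOperator_zero : IsSymmetricOperator G0 :=
  isClosed_setOf_isSymmetricOperator.mem_of_tendsto hG0
    (eventually_mem_nhdsWithin.mono fun t ht => hG.1 t ht)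

include hGinf

theorem IsCompletelyMonotonicTensor.isRelaxation {E : Matrix (Fin d) (Fin d) ℝ} (hE : E.IsSymm) :
    IsRelaxation (fun t => quadForm (G t) E) (deriv fun t => quadForm (G t) E)
      (deriv (deriv fun t => quadForm (G t) E)) (quadForm G0 E) (quadForm Ginf E) :=
  (hG.2 E hE).isRelaxation (((continuous_quadForm E).tendsto G0).comp hG0)
    (((continuous_quadForm E).tendsto Ginf).comp hGinf)

theorem IsCompletelyMonotonicTensor.isPosDefOperator_zero (hpos : IsPosDefOperator Ginf) :
    IsPosDefOperator G0 := fun E hE hE0 => by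
  have h := hG.isRelaxation hG0 hGinf hE
  exact (hpos E hE hE0).trans_le ((h.right_le one_pos).trans (h.le_left one_pos))

/-- By polarization each component is a difference of two completely monotonic functions, so the
scalar results apply to it. -/
theorem IsCompletelyMonotonicTensor.exists_tendsto_laplaceModulus (i j k l : Fin d) :
    ∃ F : ℂ → ℂ, (∀ p : ℂ, 0 ≤ p.re →
        Tendsto (fun q => laplaceModulus G q i j k l) (𝓝[{q : ℂ | 0 < q.re}] p) (𝓝 (F p))) ∧
      Tendsto F atInftyRight (𝓝 (G0 i j k l : ℂ)) := by
  have hp := hG.isRelaxation hG0 hGinf ((isSymm_symUnit i j).add (isSymm_symUnit k l))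
  have hm := hG.isRelaxation hG0 hGinf ((isSymm_symUnit i j).sub (isSymm_symUnit k l))
  refine ⟨_, fun p _ => Tendsto.congr' ?_
    (((hp.tendsto_mul_laplace p).sub (hm.tendsto_mul_laplace p)).div_const 16), ?_⟩
  · filter_upwards [self_mem_nhdsWithin] with q hq
    rw [← mul_sub, ← integral_sub (hp.integrableOn_laplace hq) (hm.integrableOn_laplace hq),
      mul_div_assoc, ← integral_div, laplaceModulus]
    congr 1
    refine setIntegral_congr_fun measurableSet_Ioi fun t ht => ?_
    rw [(hG.1 t ht).apply_eq i j k l]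
    push_cast
    ring
  · have := (hp.tendsto_atInftyRight.sub hm.tendsto_atInftyRight).div_const 16
    rw [(hG.isSymmetricOperator_zero hG0).apply_eq i j k l]
    push_cast
    exact this

theorem IsCompletelyMonotonicTensor.tendsto_complexModulus :
    Tendsto (complexModulus G) atInftyRight (𝓝 fun i j k l => (G0 i j k l : ℂ)) := by
  choose F hF hF' using hG.exists_tendsto_laplaceModulus hG0 hGinf
  have h : (fun p i j k l => F i j k l p) =ᶠ[atInftyRight] complexModulus G := by
    filter_upwards [mem_inf_of_right (mem_principal_self _)] with p hp
    refine (extendFrom_eq ?_ ?_).symm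
    · rw [Complex.closure_setOfPred_lt_re]; exact hp
    · simp only [tendsto_pi_nhds]
      exact fun i j k l => hF i j k l p hp
  refine Tendsto.congr' h ?_
  simp only [tendsto_pi_nhds]
  exact hF'

end Modulus

/-! ### Limits at infinity in the right half-plane -/

instance : atInftyRight.IsCountablyGenerated := by
  have : (Bornology.cobounded ℂ).IsCountablyGenerated := by
    rw [← comap_norm_atTop]; infer_instance
  unfold atInftyRight
  infer_instance

theorem tendsto_neg_I_mul_atInftyRight :
    Tendsto (fun ω : ℝ => -Complex.I * (ω : ℂ)) atTop atInftyRight := by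
  refine tendsto_inf.2 ⟨?_, tendsto_principal.2 (Eventually.of_forall fun ω => by simp)⟩
  rw [← tendsto_norm_atTop_iff_cobounded]
  simpa using tendsto_abs_atTop_atTop

instance : atInftyRight.NeBot := tendsto_neg_I_mul_atInftyRight.neBot

theorem eventually_ne_zero_atInftyRight : ∀ᶠ p in atInftyRight, p ≠ 0 :=
  (Bornology.eventually_ne_cobounded 0).filter_mono inf_le_left

theorem isLittleO_smul_of_tendsto_zero {d : ℕ} {N : ℂ → Matrix (Fin d) (Fin d) ℂ} {l : Filter ℂ}
    (h : Tendsto N l (𝓝 0)) : (fun p => p • N p) =o[l] fun p : ℂ => p := by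
  simpa using (isBigO_refl (fun p : ℂ => p) l).smul_isLittleO ((isLittleO_one_iff ℂ).2 h)

/-- On the closed half-plane `(p + r)⁻¹` is dominated by `2 (1 + r)⁻¹` as soon as `1 ≤ |p|`. -/
theorem norm_inv_add_ofReal_le {p : ℂ} (hp : 0 ≤ p.re) (hp1 : 1 ≤ ‖p‖) {r : ℝ} (hr : 0 ≤ r) :
    ‖(p + (r : ℂ))⁻¹‖ ≤ 2 * (1 + r)⁻¹ := by
  have h1 : (1 + r) / 2 ≤ ‖p + (r : ℂ)‖ := by
    refine le_of_sq_le_sq ?_ (norm_nonneg _)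
    have e1 : ‖p + (r : ℂ)‖ ^ 2 = ‖p‖ ^ 2 + 2 * r * p.re + r ^ 2 := by
      rw [← Complex.normSq_eq_norm_sq, ← Complex.normSq_eq_norm_sq, Complex.normSq_apply,
        Complex.normSq_apply]
      simp
      ring
    rw [e1]
    nlinarith [mul_nonneg hr hp, sq_nonneg (r - 1)]
  rw [norm_inv, ← div_eq_mul_inv, ← inv_div]
  exact inv_anti₀ (by positivity) h1

/-- Complexification of matrices as a continuous real linear map. -/
noncomputable def complexifyCLM (d : ℕ) : Matrix (Fin d) (Fin d) ℝ →L[ℝ] Matrix (Fin d) (Fin d) ℂ :=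
  LinearMap.toContinuousLinearMap (Complex.ofRealCLM.toLinearMap.mapMatrix)

/-- The integral term of a representation is `p` times a function that tends to zero, by dominated
convergence. -/
theorem tendsto_integral_inv_add_smul {d : ℕ} {K : ℂ → Matrix (Fin d) (Fin d) ℂ}
    {B : Matrix (Fin d) (Fin d) ℝ} {μ : Measure ℝ} {M : ℝ → Matrix (Fin d) (Fin d) ℝ}
    (h : IsCBFRepresentation K B μ M) :
    Tendsto (fun p : ℂ => ∫ r in Set.Ioi (0 : ℝ), (p + (r : ℂ))⁻¹ • (M r).map Complex.ofReal ∂μ)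
      atInftyRight (𝓝 0) := by
  have hmeas : AEStronglyMeasurable (fun r => (M r).map Complex.ofReal)
      (μ.restrict (Set.Ioi 0)) :=
    (complexifyCLM d).continuous.comp_aestronglyMeasurable h.measurable
  have hre : ∀ᶠ p in atInftyRight, 0 ≤ p.re := mem_inf_of_right (mem_principal_self _)
  have hnorm : Tendsto (fun p : ℂ => ‖p‖) atInftyRight atTop :=
    tendsto_norm_cobounded_atTop.mono_left inf_le_left
  rw [← integral_zero ℝ (Matrix (Fin d) (Fin d) ℂ) (μ := μ.restrict (Set.Ioi 0))]
  refine tendsto_integral_filter_of_dominated_convergence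
    (fun r => 2 * (1 + r)⁻¹ * ‖complexifyCLM d‖) ?_ ?_ ((h.integrable.const_mul 2).mul_const _) ?_
  · refine Eventually.of_forall fun p => ?_
    have hc : AEStronglyMeasurable (fun r : ℝ => (p + (r : ℂ))⁻¹) (μ.restrict (Set.Ioi 0)) :=
      Measurable.aestronglyMeasurable (by fun_prop)
    exact hc.smul hmeas
  · filter_upwards [hre, hnorm.eventually_ge_atTop 1] with p hp hp1
    filter_upwards [ae_restrict_mem measurableSet_Ioi, h.norm_le_ae] with r hr hM
    rw [norm_smul]
    refine mul_le_mul (norm_inv_add_ofReal_le hp hp1 (le_of_lt hr)) ?_ (norm_nonneg _) ?_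
    · exact (complexifyCLM d).le_of_opNorm_le_of_le le_rfl hM |>.trans_eq (mul_one _)
    · have : (0 : ℝ) < r := hr
      positivity
  · refine ae_of_all _ fun r => ?_
    have h1 : Tendsto (fun p : ℂ => (p + (r : ℂ))⁻¹) atInftyRight (𝓝 0) := by
      exact (tendsto_inv₀_cobounded.comp (tendsto_add_const_cobounded _)).mono_left inf_le_left
    simpa using h1.smul_const ((M r).map Complex.ofReal)

/-! ### The wave matrix at high frequency -/

/-- The complex slowness matrix `K_n(p) / p`, written as `ρ^{1/2} Q_n(p)^{-1/2}` so that no division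
by `p` is involved. -/
noncomputable def slownessMatrix {d : ℕ} (ρ : ℝ) (G : ℝ → Tensor4 d)
    (n : EuclideanSpace ℝ (Fin d)) (p : ℂ) : Matrix (Fin d) (Fin d) ℂ :=
  (√ρ : ℂ) • (principalSqrt (acousticMatrix (complexModulus G p) n))⁻¹

theorem waveMatrix_eq {d : ℕ} (ρ : ℝ) (G : ℝ → Tensor4 d) (n : EuclideanSpace ℝ (Fin d)) (p : ℂ) :
    waveMatrix ρ G n p = p • slownessMatrix ρ G n p := by
  rw [waveMatrix, slownessMatrix, smul_smul, mul_comm]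

theorem inv_map_ofReal {d : ℕ} {A : Matrix (Fin d) (Fin d) ℝ} (hA : IsUnit A) :
    (A.map Complex.ofReal)⁻¹ = A⁻¹.map Complex.ofReal := by
  refine Matrix.inv_eq_left_inv ?_
  have h : A⁻¹ * A = 1 := Matrix.nonsing_inv_mul A ((Matrix.isUnit_iff_isUnit_det A).1 hA)
  have h2 : (A⁻¹ * A).map Complex.ofReal = A⁻¹.map Complex.ofReal * A.map Complex.ofReal :=
    Matrix.map_mul (f := Complex.ofRealHom)
  rw [← h2, h]
  exact Matrix.map_one _ Complex.ofReal_zero Complex.ofReal_one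

theorem continuousAt_matrix_inv {d : ℕ} {A : Matrix (Fin d) (Fin d) ℂ} (hA : IsUnit A) :
    ContinuousAt (fun X : Matrix (Fin d) (Fin d) ℂ => X⁻¹) A := by
  have hcomplete : CompleteSpace (Matrix (Fin d) (Fin d) ℂ) := FiniteDimensional.complete ℂ _
  obtain ⟨u, rfl⟩ := hA
  have := NormedRing.inverse_continuousAt u
  have e : (fun X : Matrix (Fin d) (Fin d) ℂ => X⁻¹) = Ring.inverse :=
    funext fun X => X.nonsing_inv_eq_ringInverse
  rwa [e]

section Limit

variable {d : ℕ} {ρ : ℝ} (hρ : 0 < ρ) {G : ℝ → Tensor4 d} {G0 : Tensor4 d}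
  {n : EuclideanSpace ℝ (Fin d)} (hpos : (realAcousticMatrix G0 n).PosDef)
include hρ hpos

/-- One real matrix `R` is behind all square roots: `R` is that of `ρ⁻¹ G⁰_n`, `ρ^{1/2} R` that of
`G⁰_n`, and `B_n = R⁻¹`. -/
theorem exists_posDef_sqrt_instantAcousticMatrix :
    ∃ R : Matrix (Fin d) (Fin d) ℝ, R.PosDef ∧
      IsPrincipalSqrt (instantAcousticMatrix ρ G0 n) (R.map Complex.ofReal) ∧
      IsPrincipalSqrt (acousticMatrix (fun i j k l => (G0 i j k l : ℂ)) n)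
        ((√ρ : ℂ) • R.map Complex.ofReal) ∧
      wavefrontMatrix ρ G0 n = R⁻¹.map Complex.ofReal := by
  obtain ⟨R, hR, hRR⟩ := exists_posDef_mul_self_eq (hpos.smul (inv_pos.2 hρ))
  have e1 : (R * R).map Complex.ofReal = instantAcousticMatrix ρ G0 n := by
    rw [hRR, instantAcousticMatrix, ← map_ofReal_realAcousticMatrix]
    ext i j
    simp
  have e2 : ((√ρ • R) * (√ρ • R)).map Complex.ofReal
      = acousticMatrix (fun i j k l => (G0 i j k l : ℂ)) n := by
    rw [← map_ofReal_realAcousticMatrix, smul_mul_smul_comm, Real.mul_self_sqrt hρ.le, hRR,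
      smul_smul, mul_inv_cancel₀ hρ.ne', one_smul]
  have e3 : (√ρ • R).map Complex.ofReal = (√ρ : ℂ) • R.map Complex.ofReal := by
    ext i j
    simp
  have h1 := isPrincipalSqrt_map_ofReal hR
  have h2 := isPrincipalSqrt_map_ofReal (hR.smul (Real.sqrt_pos.2 hρ))
  rw [e1] at h1
  rw [e2, e3] at h2
  refine ⟨R, hR, h1, h2, ?_⟩
  rw [wavefrontMatrix, principalSqrt_eq h1, inv_map_ofReal hR.isUnit]

theorem exists_posDef_map_eq_wavefrontMatrix : ∃ B : Matrix (Fin d) (Fin d) ℝ, B.PosDef ∧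
    B.map Complex.ofReal = wavefrontMatrix ρ G0 n := by
  obtain ⟨R, hR, -, -, h⟩ := exists_posDef_sqrt_instantAcousticMatrix hρ hpos
  exact ⟨R⁻¹, hR.inv, h.symm⟩

theorem wavefrontMatrix_mul_self_mul :
    wavefrontMatrix ρ G0 n * wavefrontMatrix ρ G0 n * instantAcousticMatrix ρ G0 n = 1 := by
  obtain ⟨R, hR, h1, -, h⟩ := exists_posDef_sqrt_instantAcousticMatrix hρ hpos
  have hu : IsUnit (R.map Complex.ofReal) := (posDef_map_ofReal hR).isUnit
  have hinv : (R.map Complex.ofReal)⁻¹ * R.map Complex.ofReal = 1 :=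
    Matrix.nonsing_inv_mul _ ((Matrix.isUnit_iff_isUnit_det _).1 hu)
  rw [h, ← inv_map_ofReal hR.isUnit, ← h1.1, mul_assoc,
    ← mul_assoc _ (R.map Complex.ofReal), hinv, one_mul, hinv]

theorem isSelfAdjoint_wavefrontMatrix : IsSelfAdjoint (wavefrontMatrix ρ G0 n) := by
  obtain ⟨B, hB, h⟩ := exists_posDef_map_eq_wavefrontMatrix hρ hpos
  rw [← h]
  exact (posDef_map_ofReal hB).isHermitian

theorem tendsto_slownessMatrix
    (hQ : Tendsto (complexModulus G) atInftyRight (𝓝 fun i j k l => (G0 i j k l : ℂ))) :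
    Tendsto (slownessMatrix ρ G n) atInftyRight (𝓝 (wavefrontMatrix ρ G0 n)) := by
  obtain ⟨R, hR, -, h2, h⟩ := exists_posDef_sqrt_instantAcousticMatrix hρ hpos
  have hs : (√ρ : ℂ) ≠ 0 := by exact_mod_cast (Real.sqrt_pos.2 hρ).ne'
  have hu : IsUnit ((√ρ : ℂ) • R.map Complex.ofReal) :=
    (posDef_map_ofReal hR).isUnit.smul (Units.mk0 _ hs)
  have t1 := ((continuous_acousticMatrix n).tendsto _).comp hQ
  have t2 := h2.continuousAt.tendsto.comp t1
  rw [principalSqrt_eq h2] at t2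
  have t3 := ((continuousAt_matrix_inv hu).tendsto.comp t2).const_smul (√ρ : ℂ)
  have e : (√ρ : ℂ) • ((√ρ : ℂ) • R.map Complex.ofReal)⁻¹ = wavefrontMatrix ρ G0 n := by
    rw [h, ← inv_map_ofReal hR.isUnit]
    symm
    refine Matrix.inv_eq_left_inv ?_
    rw [smul_mul_assoc, ← mul_smul_comm]
    exact Matrix.nonsing_inv_mul _ ((Matrix.isUnit_iff_isUnit_det _).1 hu)
  rw [e] at t3
  exact t3

end Limit

theorem tendsto_realPart {d : ℕ} {α : Type*} {l : Filter α} {N : α → Matrix (Fin d) (Fin d) ℂ}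
    {B : Matrix (Fin d) (Fin d) ℂ} (h : Tendsto N l (𝓝 B)) :
    Tendsto (fun x => (ℜ (N x) : Matrix (Fin d) (Fin d) ℂ)) l (𝓝 (ℜ B)) := by
  simp only [realPart_apply_coe]
  exact (h.add h.star).const_smul _

end Viscoelastic

open Viscoelastic in
theorem mainTheorem9 {d : ℕ} (ρ : ℝ) (hρ : 0 < ρ)
    (G : ℝ → Viscoelastic.Tensor4 d)
    (hG : Viscoelastic.IsCompletelyMonotonicTensor G)
    (G0 : Viscoelastic.Tensor4 d) (hG0 : Tendsto G (𝓝[>] 0) (𝓝 G0))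
    (Ginf : Viscoelastic.Tensor4 d) (hGinf : Tendsto G atTop (𝓝 Ginf))
    (hsolid : Viscoelastic.IsPosDefOperator Ginf)
    (n : EuclideanSpace ℝ (Fin d)) (hn : ‖n‖ = 1) :
    -- `B_n = (ρ⁻¹ G⁰_n)^{-1/2}` is real symmetric and positive definite
    ((∃ B : Matrix (Fin d) (Fin d) ℝ, B.PosDef ∧
        B.map Complex.ofReal = Viscoelastic.wavefrontMatrix ρ G0 n) ∧
      Viscoelastic.wavefrontMatrix ρ G0 n * Viscoelastic.wavefrontMatrix ρ G0 n
        * Viscoelastic.instantAcousticMatrix ρ G0 n = 1) ∧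
    -- `K_n(p) - p B_n = o(p)`
    ((fun p : ℂ => Viscoelastic.waveMatrix ρ G n p - p • Viscoelastic.wavefrontMatrix ρ G0 n)
      =o[Viscoelastic.atInftyRight] fun p : ℂ => p) ∧
    -- in any integral representation of `K_n` as a complete Bernstein function, `B_n` is the
    -- coefficient of the linear term and the integral term is `o(p)`
    (∀ (B : Matrix (Fin d) (Fin d) ℝ) (μ : Measure ℝ) (M : ℝ → Matrix (Fin d) (Fin d) ℝ),
      Viscoelastic.IsCBFRepresentation (Viscoelastic.waveMatrix ρ G n) B μ M →
        B.map Complex.ofReal = Viscoelastic.wavefrontMatrix ρ G0 n ∧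
        Viscoelastic.cbfIntegral μ M =o[Viscoelastic.atInftyRight] fun p : ℂ => p) ∧
    -- the attenuation grows sublinearly
    Tendsto (fun ω : ℝ => (ω : ℂ)⁻¹ • Viscoelastic.attenuation ρ G n ω) atTop (𝓝 0) ∧
    -- the inverse phase speed tends to `B_n`
    Tendsto (fun ω : ℝ => Viscoelastic.inversePhaseSpeed ρ G n ω) atTop
      (𝓝 (Viscoelastic.wavefrontMatrix ρ G0 n)) := by
  have hn0 : n ≠ 0 := by
    rintro rfl
    simp at hn
  have hpos : (realAcousticMatrix G0 n).PosDef :=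
    posDef_realAcousticMatrix (hG.isSymmetricOperator_zero hG0)
      (hG.isPosDefOperator_zero hG0 hGinf hsolid) hn0
  have hlim : Tendsto (slownessMatrix ρ G n) atInftyRight (𝓝 (wavefrontMatrix ρ G0 n)) :=
    tendsto_slownessMatrix hρ hpos (hG.tendsto_complexModulus hG0 hGinf)
  have hsa : IsSelfAdjoint (wavefrontMatrix ρ G0 n) := isSelfAdjoint_wavefrontMatrix hρ hpos
  have hfreq : Tendsto (fun ω : ℝ => slownessMatrix ρ G n (-Complex.I * ω)) atTop
      (𝓝 (wavefrontMatrix ρ G0 n)) := hlim.comp tendsto_neg_I_mul_atInftyRight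
  refine ⟨⟨exists_posDef_map_eq_wavefrontMatrix hρ hpos, wavefrontMatrix_mul_self_mul hρ hpos⟩,
    ?_, fun B μ M h => ?_, ?_, ?_⟩
  · simp_rw [waveMatrix_eq, ← smul_sub]
    refine isLittleO_smul_of_tendsto_zero ?_
    simpa using hlim.sub_const (wavefrontMatrix ρ G0 n)
  · have hint := tendsto_integral_inv_add_smul h
    refine ⟨tendsto_nhds_unique ?_ hlim, isLittleO_smul_of_tendsto_zero hint⟩
    have h1 := hint.const_add (B.map Complex.ofReal)
    rw [add_zero] at h1
    refine h1.congr' ?_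
    filter_upwards [eventually_ne_zero_atInftyRight,
      mem_inf_of_right (mem_principal_self _)] with p hp0 hp
    have h2 := h.eq_on p hp
    rw [waveMatrix_eq, cbfIntegral, ← smul_add] at h2
    exact (smul_right_injective _ hp0 h2).symm
  -- `A_n(ω) / ω` is the Hermitian part of `-i` times the slowness, whose limit is Hermitian
  · have h1 := tendsto_realPart (hfreq.const_smul (-Complex.I))
    have h2 : (ℜ (-Complex.I • wavefrontMatrix ρ G0 n) : Matrix (Fin d) (Fin d) ℂ) = 0 := by
      rw [neg_smul, map_neg, realPart_I_smul, hsa.imaginaryPart]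
      simp
    rw [h2] at h1
    refine h1.congr' ?_
    filter_upwards [eventually_gt_atTop 0] with ω hω
    have hω0 : (ω : ℂ) ≠ 0 := by exact_mod_cast hω.ne'
    have h3 : waveMatrix ρ G n (-Complex.I * ω)
        = (ω : ℂ) • (-Complex.I • slownessMatrix ρ G n (-Complex.I * ω)) := by
      rw [waveMatrix_eq, smul_smul, mul_comm (ω : ℂ)]
    rw [attenuation, h3, realPart_smul (ω : ℂ), Complex.ofReal_re, Complex.ofReal_im, zero_smul,
      sub_zero, selfAdjoint.val_smul, ← Complex.coe_smul, inv_smul_smul₀ hω0]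
  · have h1 := tendsto_realPart hfreq
    rw [hsa.coe_realPart] at h1
    refine h1.congr' ?_
    filter_upwards [eventually_gt_atTop 0] with ω hω
    have hω0 : -Complex.I * (ω : ℂ) ≠ 0 :=
      mul_ne_zero (neg_ne_zero.2 Complex.I_ne_zero) (by exact_mod_cast hω.ne')
    rw [inversePhaseSpeed, waveMatrix_eq, inv_smul_smul₀ hω0]
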